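/- Let $\mathbb U$ be a (real or complex) Banach Lie group: a group that is also an analytic manifold, without boundary, modelled on a real or complex Banach space, with analytic multiplication and inversion. Let $d$ be a left-invariant or right-invariant metric on $\mathbb U$ that induces its topology. Let $S\subseteq\mathbb U$ be ad-bounded, meaning that the set of operators $\mathrm{Ad}(S)\subset GL(\mathfrak u)$ on the Lie algebra $\mathfrak u=\mathrm{Lie}(\mathbb U)$ is bounded: $\sup_{g\in S}\|\mathrm{Ad}_g\|<\infty$ for one (equivalently, every) norm on $\mathfrak u$ defining its Banach space topology. Then for every $\varepsilon>0$ there is $\delta>0$ such that, for every compact topological group $\mathbb K$ and every continuous map $\varphi:\mathbb K\to\mathbb U$ with $\varphi(\mathbb K)\subseteq S$ and $$d\bigl(\varphi(st),\,\varphi(s)\varphi(t)\bigr)<\delta\qquad\text{for all } s,t\in\mathbb K,$$ there is a continuous group morphism $\psi:\mathbb K\to\mathbb U$ with $d(\varphi(s),\psi(s))<\varepsilon$ for all $s\in\mathbb K$. In particular $\delta$ does not depend on $\mathbb K$ or $\varphi$. -/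

import Mathlib

open scoped Manifold ContDiff

/-- The adjoint representation of a Lie group `U` modelled on `E`: `Ad g` is the derivative at `1`
of the conjugation `x ↦ g * x * g⁻¹`, an endomorphism of the Lie algebra `T₁U`. In Mathlib `T₁U` is
a copy of the model space `E`, identified with it by the preferred chart at `1`, and `Ad g` is
recorded as an operator on `E`, so that it has an operator norm. -/
noncomputable def lieAd (𝕜 : Type*) [RCLike 𝕜] {E : Type*} [NormedAddCommGroup E] [NormedSpace 𝕜 E]
    {U : Type*} [TopologicalSpace U] [ChartedSpace E U] [Group U] (g : U) : E →L[𝕜] E :=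
  (mfderiv 𝓘(𝕜, E) 𝓘(𝕜, E) (fun x : U => g * x * g⁻¹) (1 : U) :)

/-- `S ⊆ U` is ad-bounded: the operators `Ad g`, `g ∈ S`, are uniformly bounded. -/
def IsAdBounded (𝕜 : Type*) [RCLike 𝕜] {E : Type*} [NormedAddCommGroup E] [NormedSpace 𝕜 E]
    {U : Type*} [TopologicalSpace U] [ChartedSpace E U] [Group U] (S : Set U) : Prop :=
  ∃ C : ℝ, ∀ g ∈ S, ‖lieAd 𝕜 (E := E) g‖ ≤ C

/-- `φ` is a `δ`-morphism: `d (φ (s t), φ s φ t) < δ` for all `s, t`. -/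
def IsDeltaMorphism {K U : Type*} [Group K] [Group U] [MetricSpace U] (δ : ℝ) (φ : K → U) : Prop :=
  ∀ s t : K, dist (φ (s * t)) (φ s * φ t) < δ

/-- The metric of `U` is left-invariant or right-invariant. -/
def IsLeftOrRightInvariantMetric (U : Type*) [Group U] [MetricSpace U] : Prop :=
  (∀ a x y : U, dist (a * x) (a * y) = dist x y) ∨ (∀ a x y : U, dist (x * a) (y * a) = dist x y)

/-!
In a chart centred at `1` the group law is addition up to quadratic errors. The defect
`φ s * φ t * (φ (s * t))⁻¹` of an approximate morphism then satisfies, again up to quadratic errors,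
the equation of a 2-cocycle with values in the Lie algebra, on which `Ad ∘ φ` is almost an action
of `K`. Averaging over Haar measure writes it as a coboundary, and this gives a correction of `φ`
which squares the size of the defect, up to a constant; iterating converges to a morphism near `φ`.

The constants must not depend on `φ`, so `x ↦ g * x * g⁻¹` has to be close to `Ad g` uniformly in
`‖Ad g‖`. Every single conjugation is well approximated at `1`, but on a neighbourhood depending on
`g`; moving in small steps along rays from `1` makes the neighbourhood uniform.

For a right-invariant metric the defect is near `1` by hypothesis. For a left-invariant metric its
conjugate `(φ (s * t))⁻¹ * (φ s * φ t)` is, and ad-boundedness transfers smallness from one to the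
other.
-/

open Filter Topology Metric Set

/-! ### Charts and defects -/

section CoordBall

variable {U E : Type*} [TopologicalSpace U] [NormedAddCommGroup E]
  {κ : OpenPartialHomeomorph U E} {ρ : ℝ} {x : U}

/-- The points of the domain of the chart `κ` whose coordinates have norm at most `ρ`. It plays the
role of a closed ball of radius `ρ` around the point with coordinate `0`. -/
def coordBall (κ : OpenPartialHomeomorph U E) (ρ : ℝ) : Set U := {x | x ∈ κ.source ∧ ‖κ x‖ ≤ ρ}

theorem coordBall_mono : Monotone (coordBall κ) := fun _ _ h _ hx => ⟨hx.1, hx.2.trans h⟩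

theorem symm_mem_coordBall {v : E} (hv : v ∈ κ.target) : κ.symm v ∈ coordBall κ ‖v‖ :=
  ⟨κ.map_target hv, (congrArg norm (κ.right_inv hv)).le⟩

theorem coordBall_mem_nhds (hx : x ∈ κ.source) (hκx : κ x = 0) (hρ : 0 < ρ) :
    coordBall κ ρ ∈ 𝓝 x := by
  have hball : closedBall 0 ρ ∈ 𝓝 (κ x) := by
    rw [hκx]
    exact closedBall_mem_nhds 0 hρ
  filter_upwards [κ.open_source.mem_nhds hx, κ.continuousAt hx hball] with y hy hy'
  exact ⟨hy, mem_closedBall_zero_iff.1 hy'⟩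

theorem tendsto_symm_nhds_zero (hx : x ∈ κ.source) (hκx : κ x = 0) :
    Tendsto κ.symm (𝓝 0) (𝓝 x) :=
  hκx ▸ κ.tendsto_symm hx

theorem eventually_coordBall_subset (hx : x ∈ κ.source) (hκx : κ x = 0) {W : Set U}
    (hW : W ∈ 𝓝 x) : ∀ᶠ ρ in 𝓝[>] (0 : ℝ), coordBall κ ρ ⊆ W := by
  obtain ⟨σ, hσ, hσW⟩ := Metric.mem_nhds_iff.1 (tendsto_symm_nhds_zero hx hκx hW)
  filter_upwards [Ioo_mem_nhdsGT hσ] with ρ hρ y hy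
  have : κ.symm (κ y) ∈ W := hσW (mem_ball_zero_iff.2 (hy.2.trans_lt hρ.2))
  rwa [κ.left_inv hy.1] at this

theorem exists_continuous_tendsto_of_coord_geometric [CompleteSpace E] {K : Type*}
    [TopologicalSpace K] {w : ℕ → K → U} {R C : ℝ} (hR : closedBall 0 R ⊆ κ.target)
    (hw : ∀ n, Continuous (w n)) (hwR : ∀ n s, w n s ∈ coordBall κ R)
    (hdist : ∀ n s, dist (κ (w n s)) (κ (w (n + 1) s)) ≤ C / 2 / 2 ^ n) :
    ∃ w' : K → U, Continuous w' ∧ (∀ s, w' s ∈ coordBall κ R) ∧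
      ∀ s, Tendsto (fun n => w n s) atTop (𝓝 (w' s)) := by
  choose u hu using fun s => cauchySeq_tendsto_of_complete
    (cauchySeq_of_le_geometric_two fun n => hdist n s)
  have huR (s : K) : ‖u s‖ ≤ R :=
    le_of_tendsto (hu s).norm (Eventually.of_forall fun n => (hwR n s).2)
  have hut (s : K) : u s ∈ κ.target := hR (mem_closedBall_zero_iff.2 (huR s))
  have hunif : TendstoUniformly (fun n s => κ (w n s)) u atTop := by
    have hpow : Tendsto (fun n : ℕ => C / 2 ^ n) atTop (𝓝 0) :=
      tendsto_const_nhds.div_atTop (tendsto_pow_atTop_atTop_of_one_lt one_lt_two)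
    refine Metric.tendstoUniformly_iff.2 fun e he => ?_
    filter_upwards [hpow.eventually_lt_const he] with n hn s
    rw [dist_comm]
    exact (dist_le_of_le_geometric_two_of_tendsto (hdist · s) (hu s) n).trans_lt hn
  have huc : Continuous u := hunif.continuous (Frequently.of_forall fun n =>
    κ.continuousOn.comp_continuous (hw n) fun s => (hwR n s).1)
  refine ⟨fun s => κ.symm (u s), κ.continuousOn_symm.comp_continuous huc hut,
    fun s => coordBall_mono (huR s) (symm_mem_coordBall (hut s)), fun s => ?_⟩
  exact ((κ.continuousAt_symm (hut s)).tendsto.comp (hu s)).congr fun n => κ.left_inv (hwR n s).1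

end CoordBall

section MulDefect

variable {K U : Type*} [Group K] [Group U]

/-- The failure of `φ` to be multiplicative: `φ s * φ t = mulDefect φ s t * φ (s * t)`. -/
def mulDefect (φ : K → U) (s t : K) : U := φ s * φ t * (φ (s * t))⁻¹

theorem mulDefect_mul_mulDefect (φ : K → U) (r s t : K) :
    mulDefect φ r s * mulDefect φ (r * s) t =
      φ r * mulDefect φ s t * (φ r)⁻¹ * mulDefect φ r (s * t) := by
  simp [mulDefect, mul_assoc]

theorem mulDefect_mul (γ φ : K → U) (r s : K) :
    mulDefect (γ * φ) r s =
      γ r * (φ r * γ s * (φ r)⁻¹) * (mulDefect φ r s * (γ (r * s))⁻¹) := by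
  simp [mulDefect, mul_assoc]

theorem continuous_mulDefect [TopologicalSpace K] [TopologicalSpace U] [ContinuousMul K]
    [IsTopologicalGroup U] {φ : K → U} (hφ : Continuous φ) :
    Continuous fun p : K × K => mulDefect φ p.1 p.2 := by
  unfold mulDefect
  fun_prop

theorem map_mul_of_tendsto_mulDefect [TopologicalSpace U] [IsTopologicalGroup U] [T2Space U]
    {ι : Type*} {l : Filter ι} [l.NeBot] {φ : ι → K → U} {ψ : K → U}
    (hφ : ∀ s, Tendsto (fun i => φ i s) l (𝓝 (ψ s)))
    (hdefect : ∀ s t, Tendsto (fun i => mulDefect (φ i) s t) l (𝓝 1)) (s t : K) :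
    ψ (s * t) = ψ s * ψ t :=
  (mul_inv_eq_one.1 (tendsto_nhds_unique (((hφ s).mul (hφ t)).mul (hφ (s * t)).inv)
    (hdefect s t))).symm

end MulDefect

open MeasureTheory in
/-- Integrating the cocycle relation in `t` against Haar measure: by left invariance the two terms
involving `t` in the second argument become values of `b s = ∫ a (s, t) dt`. -/
theorem exists_norm_coboundary_sub_le {K E : Type*} [Group K] [TopologicalSpace K]
    [IsTopologicalGroup K] [CompactSpace K] [NormedAddCommGroup E] [NormedSpace ℝ E]
    [CompleteSpace E] {a : K × K → E} (ha : Continuous a) (T : K → E →L[ℝ] E) {δ e : ℝ}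
    (hδ : ∀ p, ‖a p‖ ≤ δ)
    (hcocycle : ∀ r s t, ‖a (r, s) + a (r * s, t) - T r (a (s, t)) - a (r, s * t)‖ ≤ e) :
    ∃ b : K → E, Continuous b ∧ (∀ s, ‖b s‖ ≤ δ) ∧
      ∀ r s, ‖a (r, s) + b (r * s) - T r (b s) - b r‖ ≤ e := by
  borelize K
  set μ := Measure.haarMeasure (⊤ : TopologicalSpace.PositiveCompacts K)
  have : IsProbabilityMeasure μ := ⟨Measure.haarMeasure_self⟩
  have hint {f : K → E} (hf : Continuous f) : Integrable f μ :=
    hf.integrable_of_hasCompactSupport (HasCompactSupport.of_compactSpace f)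
  have norm_integral_le {f : K → E} {C : ℝ} (hf : ∀ t, ‖f t‖ ≤ C) : ‖∫ t, f t ∂μ‖ ≤ C := by
    simpa using norm_integral_le_of_norm_le_const (μ := μ) (Eventually.of_forall hf)
  refine ⟨fun s => ∫ t, a (s, t) ∂μ, ?_, fun s => norm_integral_le fun t => hδ _, fun r s => ?_⟩
  · rw [← continuousOn_univ]
    exact continuousOn_integral_of_compact_support isCompact_univ ha.continuousOn
      fun _ x _ hx => (hx (mem_univ x)).elim
  · have hinv : ∫ t, a (r, s * t) ∂μ = ∫ t, a (r, t) ∂μ :=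
      integral_mul_left_eq_self (fun t => a (r, t)) s
    have h₁ : Integrable (fun t => a (r * s, t)) μ := hint (by fun_prop)
    have h₂ : Integrable (fun t => a (r, s) + a (r * s, t)) μ := hint (by fun_prop)
    have h₃ : Integrable (fun t => a (s, t)) μ := hint (by fun_prop)
    have h₄ : Integrable (fun t => a (r, s) + a (r * s, t) - T r (a (s, t))) μ :=
      hint (by fun_prop)
    have hintegral : ∫ t, (a (r, s) + a (r * s, t) - T r (a (s, t)) - a (r, s * t)) ∂μ =
        a (r, s) + ∫ t, a (r * s, t) ∂μ - T r (∫ t, a (s, t) ∂μ) - ∫ t, a (r, t) ∂μ := by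
      rw [integral_sub h₄ (hint (by fun_prop)), integral_sub h₂ ((T r).integrable_comp h₃),
        integral_add (integrable_const _) h₁, (T r).integral_comp_comm h₃, hinv, integral_const,
        probReal_univ, one_smul]
    exact hintegral ▸ norm_integral_le (hcocycle r s)

/-! ### Quadratic charts -/

/-- A chart of a topological group, centred at `1`, in which multiplication and inversion are
addition and negation up to quadratic errors and conjugations are differentiable at `1`. The bound
`M * r ≤ 1 / 8` makes those errors small compared with the coordinates themselves. -/
structure QuadraticChart (U E : Type*) [TopologicalSpace U] [Group U] [NormedAddCommGroup E]
    [NormedSpace ℝ E] where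
  chart : OpenPartialHomeomorph U E
  r : ℝ
  M : ℝ
  r_pos : 0 < r
  M_nonneg : 0 ≤ M
  M_mul_r_le : M * r ≤ 1 / 8
  one_mem_source : 1 ∈ chart.source
  map_one : chart 1 = 0
  closedBall_subset_target : closedBall 0 r ⊆ chart.target
  isClosed_coordBall : IsClosed (coordBall chart r)
  mul_mem_source : ∀ x ∈ coordBall chart r, ∀ y ∈ coordBall chart r, x * y ∈ chart.source
  norm_mul_sub_sub_le : ∀ x ∈ coordBall chart r, ∀ y ∈ coordBall chart r,
    ‖chart (x * y) - chart x - chart y‖ ≤ M * ‖chart x‖ * ‖chart y‖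
  inv_mem_source : ∀ x ∈ coordBall chart r, x⁻¹ ∈ chart.source
  norm_inv_add_le : ∀ x ∈ coordBall chart r, ‖chart x⁻¹ + chart x‖ ≤ M * ‖chart x‖ ^ 2
  differentiableAt_conj : ∀ g, DifferentiableAt ℝ (fun v => chart (g * chart.symm v * g⁻¹)) 0

namespace QuadraticChart

variable {U E : Type*} [TopologicalSpace U] [Group U] [NormedAddCommGroup E] [NormedSpace ℝ E]
  {c : QuadraticChart U E}

/-- The closed ball of radius `ρ` around `1` in the coordinates of `c`. -/
abbrev ball (c : QuadraticChart U E) (ρ : ℝ) : Set U := coordBall c.chart ρ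

/-- The adjoint operator of `g`, read in the chart: the derivative at `1` of conjugation by `g`. -/
noncomputable def ad (c : QuadraticChart U E) (g : U) : E →L[ℝ] E :=
  fderiv ℝ (fun v => c.chart (g * c.chart.symm v * g⁻¹)) 0

/-- The deviation of conjugation by `g` from its linearization `c.ad g`, in coordinates. -/
noncomputable def conjError (c : QuadraticChart U E) (g x : U) : E :=
  c.chart (g * x * g⁻¹) - c.ad g (c.chart x)

variable {x y : U} {η : ℝ}

theorem M_mul_le {a : ℝ} (ha : a ≤ c.r) : c.M * a ≤ 1 / 8 :=
  (mul_le_mul_of_nonneg_left ha c.M_nonneg).trans c.M_mul_r_le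

theorem M_mul_sq_le (hη₀ : 0 ≤ η) (hη : η ≤ c.r) : c.M * η ^ 2 ≤ η / 8 := by
  nlinarith [mul_le_mul_of_nonneg_right (M_mul_le hη) hη₀]

theorem norm_mul_sub_sub_le_left (hx : x ∈ c.ball c.r) (hy : y ∈ c.ball c.r) :
    ‖c.chart (x * y) - c.chart x - c.chart y‖ ≤ ‖c.chart x‖ / 8 := by
  refine (c.norm_mul_sub_sub_le x hx y hy).trans ?_
  linarith [mul_le_mul_of_nonneg_right (M_mul_le hy.2) (norm_nonneg (c.chart x))]

theorem norm_mul_sub_sub_le_right (hx : x ∈ c.ball c.r) (hy : y ∈ c.ball c.r) :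
    ‖c.chart (x * y) - c.chart x - c.chart y‖ ≤ ‖c.chart y‖ / 8 := by
  refine (c.norm_mul_sub_sub_le x hx y hy).trans ?_
  linarith [mul_le_mul_of_nonneg_right (M_mul_le hx.2) (norm_nonneg (c.chart y))]

theorem norm_mul_sub_sub_le_sq (hη : η ≤ c.r) (hx : x ∈ c.ball η) (hy : y ∈ c.ball η) :
    ‖c.chart (x * y) - c.chart x - c.chart y‖ ≤ c.M * η ^ 2 := by
  have hη₀ : 0 ≤ η := (norm_nonneg _).trans hx.2
  calc _ ≤ c.M * ‖c.chart x‖ * ‖c.chart y‖ :=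
        c.norm_mul_sub_sub_le x (coordBall_mono hη hx) y (coordBall_mono hη hy)
    _ ≤ c.M * η * η := by have := c.M_nonneg; gcongr; exacts [hx.2, hy.2]
    _ = c.M * η ^ 2 := by ring

theorem norm_mul_sub_le (hx : x ∈ c.ball c.r) (hy : y ∈ c.ball c.r) :
    ‖c.chart (x * y) - c.chart y‖ ≤ 2 * ‖c.chart x‖ := by
  have h := norm_mul_sub_sub_le_left hx hy
  rw [sub_right_comm] at h
  linarith [norm_le_norm_add_norm_sub' (c.chart (x * y) - c.chart y) (c.chart x),
    norm_nonneg (c.chart x)]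

theorem norm_le_norm_mul_sub (hx : x ∈ c.ball c.r) (hy : y ∈ c.ball c.r) :
    ‖c.chart y‖ ≤ 2 * ‖c.chart (x * y) - c.chart x‖ := by
  linarith [norm_mul_sub_sub_le_right hx hy, norm_nonneg (c.chart y),
    norm_le_norm_add_norm_sub (c.chart (x * y) - c.chart x) (c.chart y)]

theorem mul_mem_ball (hη : η ≤ c.r) (hx : x ∈ c.ball η) (hy : y ∈ c.ball η) :
    x * y ∈ c.ball (3 * η) := by
  have hxr := coordBall_mono hη hx
  have hyr := coordBall_mono hη hy
  refine ⟨c.mul_mem_source x hxr y hyr, ?_⟩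
  linarith [norm_le_norm_add_norm_sub' (c.chart (x * y)) (c.chart y), norm_mul_sub_le hxr hyr,
    hx.2, hy.2]

theorem inv_mem_ball (hη : η ≤ c.r) (hx : x ∈ c.ball η) : x⁻¹ ∈ c.ball (2 * η) := by
  refine ⟨c.inv_mem_source x (coordBall_mono hη hx), ?_⟩
  have hinv := c.norm_inv_add_le x (coordBall_mono hη hx)
  have hnorm := norm_le_norm_add_norm_sub' (c.chart x⁻¹) (-c.chart x)
  rw [sub_neg_eq_add, norm_neg] at hnorm
  linarith [M_mul_sq_le (norm_nonneg (c.chart x)) (hx.2.trans hη), hx.2, norm_nonneg (c.chart x)]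

theorem mul_mul_mul_inv_mem_source (hη : 6 * η ≤ c.r) {x₁ x₂ x₃ x₄ : U} (h₁ : x₁ ∈ c.ball η)
    (h₂ : x₂ ∈ c.ball η) (h₃ : x₃ ∈ c.ball η) (h₄ : x₄ ∈ c.ball η) :
    x₁ * x₂ * (x₃ * x₄⁻¹) ∈ c.chart.source := by
  have hη₀ : 0 ≤ η := (norm_nonneg _).trans h₁.2
  have h₁₂ := mul_mem_ball (by linarith) h₁ h₂
  have h₃₄ := mul_mem_ball (by linarith) (coordBall_mono (by linarith) h₃)
    (inv_mem_ball (by linarith) h₄)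
  exact c.mul_mem_source _ (coordBall_mono (by linarith) h₁₂) _
    (coordBall_mono (by linarith) h₃₄)

theorem norm_mul_mul_mul_inv_sub_le (hη : 6 * η ≤ c.r) {x₁ x₂ x₃ x₄ : U} (h₁ : x₁ ∈ c.ball η)
    (h₂ : x₂ ∈ c.ball η) (h₃ : x₃ ∈ c.ball η) (h₄ : x₄ ∈ c.ball η) :
    ‖c.chart (x₁ * x₂ * (x₃ * x₄⁻¹)) -
      (c.chart x₁ + c.chart x₂ + c.chart x₃ - c.chart x₄)‖ ≤ 42 * c.M * η ^ 2 := by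
  have hη₀ : 0 ≤ η := (norm_nonneg _).trans h₁.2
  have h₄r : x₄ ∈ c.ball c.r := coordBall_mono (by linarith) h₄
  have h₃' : x₃ ∈ c.ball (2 * η) := coordBall_mono (by linarith) h₃
  have h₄' := inv_mem_ball (by linarith) h₄
  have h₁₂ : x₁ * x₂ ∈ c.ball (3 * (2 * η)) :=
    coordBall_mono (by linarith) (mul_mem_ball (by linarith) h₁ h₂)
  have e₁₂ := norm_mul_sub_sub_le_sq (by linarith) h₁ h₂
  have e₃₄ := norm_mul_sub_sub_le_sq (by linarith) h₃' h₄'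
  have e := norm_mul_sub_sub_le_sq (by linarith) h₁₂ (mul_mem_ball (by linarith) h₃' h₄')
  have e₄ : ‖c.chart x₄⁻¹ + c.chart x₄‖ ≤ c.M * η ^ 2 := by
    have := c.M_nonneg
    exact (c.norm_inv_add_le x₄ h₄r).trans (by gcongr; exact h₄.2)
  calc _ = ‖(c.chart (x₁ * x₂ * (x₃ * x₄⁻¹)) - c.chart (x₁ * x₂) - c.chart (x₃ * x₄⁻¹)) +
        (c.chart (x₁ * x₂) - c.chart x₁ - c.chart x₂) +
        (c.chart (x₃ * x₄⁻¹) - c.chart x₃ - c.chart x₄⁻¹) + (c.chart x₄⁻¹ + c.chart x₄)‖ := by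
        congr 1; abel
    _ ≤ _ := norm_add_le_of_le (norm_add_le_of_le (norm_add_le_of_le e e₁₂) e₃₄) e₄
    _ = 42 * c.M * η ^ 2 := by ring

section Conj

variable {g z : U} {C : ℝ}

variable (c)

theorem ball_mem_nhds {ρ : ℝ} (hρ : 0 < ρ) : c.ball ρ ∈ 𝓝 (1 : U) :=
  coordBall_mem_nhds c.one_mem_source c.map_one hρ

theorem tendsto_chart : Tendsto c.chart (𝓝 1) (𝓝 0) := by
  simpa only [c.map_one] using (c.chart.continuousAt c.one_mem_source).tendsto

theorem tendsto_symm : Tendsto c.chart.symm (𝓝 0) (𝓝 1) :=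
  tendsto_symm_nhds_zero c.one_mem_source c.map_one

theorem symm_zero : c.chart.symm 0 = 1 := by
  rw [← c.map_one, c.chart.left_inv c.one_mem_source]

theorem hasFDerivAt_conj (g : U) :
    HasFDerivAt (fun v => c.chart (g * c.chart.symm v * g⁻¹)) (c.ad g) 0 :=
  (c.differentiableAt_conj g).hasFDerivAt

theorem chart_conj_symm_zero (g : U) : c.chart (g * c.chart.symm 0 * g⁻¹) = 0 := by
  rw [symm_zero, mul_one, mul_inv_cancel, c.map_one]

theorem eventually_norm_conjError_le (g : U) (hη : 0 < η) :
    ∀ᶠ x in 𝓝 (1 : U), ‖c.conjError g x‖ ≤ η * ‖c.chart x‖ := by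
  filter_upwards [c.tendsto_chart.eventually ((c.hasFDerivAt_conj g).isLittleO.def hη),
    c.chart.open_source.mem_nhds c.one_mem_source] with x hx hxs
  simpa only [conjError, c.chart_conj_symm_zero, c.chart.left_inv hxs, sub_zero] using hx

variable {c}

theorem norm_conj_le (hg : ‖c.ad g‖ ≤ C) (x : U) :
    ‖c.chart (g * x * g⁻¹)‖ ≤ C * ‖c.chart x‖ + ‖c.conjError g x‖ :=
  (norm_le_norm_add_norm_sub' _ _).trans (add_le_add_left ((c.ad g).le_of_opNorm_le hg _) _)

theorem norm_conjError_mul_le (hx : x ∈ c.ball c.r) (hz : z ∈ c.ball c.r)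
    (hgx : g * x * g⁻¹ ∈ c.ball c.r) (hgz : g * z * g⁻¹ ∈ c.ball c.r) :
    ‖c.conjError g (x * z)‖ ≤ ‖c.conjError g x‖ + ‖c.conjError g z‖ +
      c.M * ‖c.chart (g * x * g⁻¹)‖ * ‖c.chart (g * z * g⁻¹)‖ +
      ‖c.ad g‖ * (c.M * ‖c.chart x‖ * ‖c.chart z‖) := by
  have hconj : g * (x * z) * g⁻¹ = g * x * g⁻¹ * (g * z * g⁻¹) := by group
  have hsplit : c.conjError g (x * z) = c.conjError g x + c.conjError g z +
      (c.chart (g * x * g⁻¹ * (g * z * g⁻¹)) - c.chart (g * x * g⁻¹) - c.chart (g * z * g⁻¹)) -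
      c.ad g (c.chart (x * z) - c.chart x - c.chart z) := by
    simp only [conjError, hconj, map_sub]
    abel
  rw [hsplit]
  exact norm_sub_le_of_le
    (norm_add_le_of_le (norm_add_le _ _) (c.norm_mul_sub_sub_le _ hgx _ hgz))
    ((c.ad g).le_opNorm_of_le (c.norm_mul_sub_sub_le x hx z hz))

theorem norm_conjError_mul_le_add (hg : ‖c.ad g‖ ≤ C) {d : ℝ} (hd : d ≤ 1)
    (hdr : (C + 1) * d ≤ c.r) (hx : x ∈ c.ball d) (hgx : g * x * g⁻¹ ∈ c.ball ((C + 1) * d))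
    (hz : z ∈ c.ball c.r) (hgz : g * z * g⁻¹ ∈ c.ball c.r)
    (hzd : ‖c.conjError g z‖ ≤ d * ‖c.chart z‖) :
    ‖c.conjError g (x * z)‖ ≤
      ‖c.conjError g x‖ + (1 + 2 * c.M * (C + 1) ^ 2) * d * ‖c.chart z‖ := by
  have hC : 0 ≤ C := (norm_nonneg _).trans hg
  have hM := c.M_nonneg
  have hd₀ : 0 ≤ d := (norm_nonneg _).trans hx.2
  have hgz' : ‖c.chart (g * z * g⁻¹)‖ ≤ (C + 1) * ‖c.chart z‖ := by
    linarith [norm_conj_le hg z, mul_le_mul_of_nonneg_right hd (norm_nonneg (c.chart z))]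
  calc ‖c.conjError g (x * z)‖
    _ ≤ _ := norm_conjError_mul_le (coordBall_mono (by nlinarith) hx) hz
        (coordBall_mono hdr hgx) hgz
    _ ≤ ‖c.conjError g x‖ + d * ‖c.chart z‖ +
        c.M * ((C + 1) * d) * ((C + 1) * ‖c.chart z‖) +
        (C + 1) ^ 2 * (c.M * d * ‖c.chart z‖) := by
      gcongr
      exacts [hgx.2, by nlinarith, hx.2]
    _ = _ := by ring

variable [IsTopologicalGroup U]

theorem tendsto_conj (g : U) : Tendsto (fun x : U => g * x * g⁻¹) (𝓝 1) (𝓝 1) :=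
  Continuous.tendsto' (by fun_prop) _ _ (by simp)

theorem norm_ad_le_two (hx : x ∈ c.ball c.r) : ‖c.ad x‖ ≤ 2 := by
  refine (c.hasFDerivAt_conj x).le_of_lip' zero_le_two ?_
  have hconj : ∀ᶠ v in 𝓝 (0 : E), x * c.chart.symm v * x⁻¹ ∈ c.ball c.r :=
    ((tendsto_conj x).comp c.tendsto_symm).eventually_mem (c.ball_mem_nhds c.r_pos)
  filter_upwards [hconj, c.tendsto_symm.eventually_mem (c.ball_mem_nhds c.r_pos),
    c.chart.open_target.mem_nhds (c.closedBall_subset_target (mem_closedBall_self c.r_pos.le))]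
    with v hz hy hv
  rw [c.chart_conj_symm_zero, sub_zero, sub_zero]
  have hzx := norm_mul_sub_sub_le_left hz hx
  have hxy := norm_mul_sub_sub_le_right hx hy
  rw [inv_mul_cancel_right, sub_right_comm] at hzx
  rw [c.chart.right_inv hv] at hxy
  set w := c.chart (x * c.chart.symm v) - c.chart x
  linarith [norm_le_norm_add_norm_sub w (c.chart (x * c.chart.symm v * x⁻¹)),
    norm_le_norm_add_norm_sub' w v, norm_nonneg v]

theorem ad_mul (c : QuadraticChart U E) (g h : U) : c.ad (g * h) = (c.ad g).comp (c.ad h) := by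
  have hg : HasFDerivAt (fun v => c.chart (g * c.chart.symm v * g⁻¹)) (c.ad g)
      (c.chart (h * c.chart.symm 0 * h⁻¹)) := by
    rw [c.chart_conj_symm_zero]
    exact c.hasFDerivAt_conj g
  refine (c.hasFDerivAt_conj (g * h)).unique
    ((hg.comp 0 (c.hasFDerivAt_conj h)).congr_of_eventuallyEq ?_)
  filter_upwards [((tendsto_conj h).comp c.tendsto_symm).eventually_mem
    (c.chart.open_source.mem_nhds c.one_mem_source)] with v hv
  have hhv : c.chart.symm (c.chart (h * c.chart.symm v * h⁻¹)) = h * c.chart.symm v * h⁻¹ :=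
    c.chart.left_inv hv
  rw [Function.comp_apply, hhv]
  group

theorem norm_ad_mul_le (hx : x ∈ c.ball c.r) (hg : ‖c.ad g‖ ≤ C) : ‖c.ad (x * g)‖ ≤ 2 * C := by
  rw [ad_mul]
  exact (ContinuousLinearMap.opNorm_comp_le _ _).trans
    (mul_le_mul (norm_ad_le_two hx) hg (norm_nonneg _) zero_le_two)

end Conj

/-! ### Conjugations with bounded adjoint operator -/

section UniformConj

variable {g : U} {v : E} {C A : ℝ}

theorem conj_mem_ball_of_norm_conjError_le (hg : ‖c.ad g‖ ≤ C) {d : ℝ}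
    (hgx : g * x * g⁻¹ ∈ c.chart.source) (hx : ‖c.chart x‖ ≤ d) (hd : ‖c.conjError g x‖ ≤ d) :
    g * x * g⁻¹ ∈ c.ball ((C + 1) * d) := by
  have hC : 0 ≤ C := (norm_nonneg _).trans hg
  exact ⟨hgx, by linarith [norm_conj_le hg x, mul_le_mul_of_nonneg_left hx hC]⟩

theorem smul_mem_closedBall (hv : ‖v‖ ≤ c.r) {t : ℝ} (ht : t ∈ Icc (0 : ℝ) 1) :
    t • v ∈ closedBall 0 c.r := by
  rw [mem_closedBall_zero_iff, norm_smul, Real.norm_of_nonneg ht.1]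
  exact (mul_le_of_le_one_left (norm_nonneg v) ht.2).trans hv

theorem chart_symm_smul (hv : ‖v‖ ≤ c.r) {t : ℝ} (ht : t ∈ Icc (0 : ℝ) 1) :
    c.chart (c.chart.symm (t • v)) = t • v :=
  c.chart.right_inv (c.closedBall_subset_target (smul_mem_closedBall hv ht))

theorem symm_smul_mem_ball (hv : ‖v‖ ≤ c.r) {t : ℝ} (ht : t ∈ Icc (0 : ℝ) 1) :
    c.chart.symm (t • v) ∈ c.ball ‖v‖ := by
  refine coordBall_mono ?_ (symm_mem_coordBall
    (c.closedBall_subset_target (smul_mem_closedBall hv ht)))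
  rw [norm_smul, Real.norm_of_nonneg ht.1]
  exact mul_le_of_le_one_left (norm_nonneg v) ht.2

theorem continuousAt_symm_smul (hv : ‖v‖ ≤ c.r) {t : ℝ} (ht : t ∈ Icc (0 : ℝ) 1) :
    ContinuousAt (fun τ : ℝ => c.chart.symm (τ • v)) t :=
  ContinuousAt.comp (g := c.chart.symm) (c.chart.continuousAt_symm
    (c.closedBall_subset_target (smul_mem_closedBall hv ht))) (by fun_prop)

/-- The times `t` at which conjugation by `g` keeps the point with coordinates `t • v` in the chart
and differs from its linearization by at most `A * t * ‖v‖ ^ 2`. The linear dependence on `t` is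
what makes the bound reproduce itself along the ray. -/
def rayControl (c : QuadraticChart U E) (g : U) (v : E) (A : ℝ) : Set ℝ :=
  {t | g * c.chart.symm (t • v) * g⁻¹ ∈ c.ball c.r ∧
    ‖c.conjError g (c.chart.symm (t • v))‖ ≤ A * t * ‖v‖ ^ 2}

theorem zero_mem_rayControl : (0 : ℝ) ∈ c.rayControl g v A := by
  simp [rayControl, conjError, coordBall, c.symm_zero, c.map_one, c.one_mem_source, c.r_pos.le]

theorem mem_rayControl_of_mul (hg : ‖c.ad g‖ ≤ C) (hA : 2 + 4 * c.M * (C + 1) ^ 2 ≤ A)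
    (hAv : A * ‖v‖ ≤ 1) (hCv : (C + 1) * ‖v‖ ≤ c.r) {t τ : ℝ} (ht : 0 ≤ t) (htτ : t ≤ τ)
    (hτ : τ ≤ 1) (hmem : t ∈ c.rayControl g v A) {z : U} (hz : z ∈ c.ball c.r)
    (hgz : g * z * g⁻¹ ∈ c.ball c.r) (hzv : ‖c.conjError g z‖ ≤ ‖v‖ * ‖c.chart z‖)
    (hmul : c.chart.symm (t • v) * z = c.chart.symm (τ • v)) : τ ∈ c.rayControl g v A := by
  have hC : 0 ≤ C := (norm_nonneg _).trans hg
  have hMC : 0 ≤ c.M * (C + 1) ^ 2 := mul_nonneg c.M_nonneg (sq_nonneg _)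
  have hv : ‖v‖ ≤ c.r := by nlinarith [norm_nonneg v]
  have hv₁ : ‖v‖ ≤ 1 := by nlinarith [norm_nonneg v]
  have hA₀ : 0 ≤ A := by linarith
  have ht' : t ∈ Icc (0 : ℝ) 1 := ⟨ht, htτ.trans hτ⟩
  have hτ' : τ ∈ Icc (0 : ℝ) 1 := ⟨ht.trans htτ, hτ⟩
  have hyt : c.chart.symm (t • v) ∈ c.ball ‖v‖ := symm_smul_mem_ball hv ht'
  have hyτ : c.chart.symm (τ • v) ∈ c.ball ‖v‖ := symm_smul_mem_ball hv hτ'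
  have error_le {σ : ℝ} (hσ : σ ∈ Icc (0 : ℝ) 1) : A * σ * ‖v‖ ^ 2 ≤ ‖v‖ := by
    calc A * σ * ‖v‖ ^ 2 = σ * (A * ‖v‖ * ‖v‖) := by ring
      _ ≤ 1 * (1 * ‖v‖) := by have := hσ.2; gcongr
      _ = ‖v‖ := by ring
  have hgt : g * c.chart.symm (t • v) * g⁻¹ ∈ c.ball ((C + 1) * ‖v‖) :=
    conj_mem_ball_of_norm_conjError_le hg hmem.1.1 hyt.2 (hmem.2.trans (error_le ht'))
  have hnorm : ‖c.chart z‖ ≤ 2 * ((τ - t) * ‖v‖) := by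
    have h := norm_le_norm_mul_sub (coordBall_mono hv hyt) hz
    rwa [hmul, chart_symm_smul hv ht', chart_symm_smul hv hτ', ← sub_smul, norm_smul,
      Real.norm_of_nonneg (sub_nonneg.2 htτ)] at h
  have herror : ‖c.conjError g (c.chart.symm (τ • v))‖ ≤ A * τ * ‖v‖ ^ 2 := by
    have h := norm_conjError_mul_le_add hg hv₁ hCv hyt hgt hz hgz hzv
    rw [hmul] at h
    have hstep : (1 + 2 * c.M * (C + 1) ^ 2) * ‖v‖ * ‖c.chart z‖ ≤ A * (τ - t) * ‖v‖ ^ 2 :=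
      calc _ ≤ A / 2 * ‖v‖ * (2 * ((τ - t) * ‖v‖)) := by gcongr; linarith
        _ = _ := by ring
    linarith [hmem.2]
  have hsource : g * c.chart.symm (τ • v) * g⁻¹ ∈ c.chart.source := by
    have h := c.mul_mem_source _ hmem.1 _ hgz
    rwa [conj_mul, hmul] at h
  exact ⟨coordBall_mono hCv (conj_mem_ball_of_norm_conjError_le hg hsource hyτ.2
    (herror.trans (error_le hτ'))), herror⟩

variable [IsTopologicalGroup U]

theorem isClosed_rayControl_inter_Icc (hv : ‖v‖ ≤ c.r) :
    IsClosed (c.rayControl g v A ∩ Icc 0 1) := by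
  have hray : ContinuousOn (fun t : ℝ => c.chart.symm (t • v)) (Icc 0 1) := fun t ht =>
    (continuousAt_symm_smul hv ht).continuousWithinAt
  have hconj : ContinuousOn (fun t : ℝ => g * c.chart.symm (t • v) * g⁻¹) (Icc 0 1) := by fun_prop
  set J : Set ℝ := Icc 0 1 ∩ (fun t : ℝ => g * c.chart.symm (t • v) * g⁻¹) ⁻¹' c.ball c.r
  have hJ : IsClosed J := hconj.preimage_isClosed_of_isClosed isClosed_Icc c.isClosed_coordBall
  have hchart : ContinuousOn (fun t : ℝ => c.chart (g * c.chart.symm (t • v) * g⁻¹)) J :=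
    c.chart.continuousOn.comp (hconj.mono inter_subset_left) fun t ht => ht.2.1
  have hcoord : ContinuousOn (fun t : ℝ => c.chart (c.chart.symm (t • v))) J :=
    ContinuousOn.congr (f := fun t : ℝ => t • v) (by fun_prop) fun t ht =>
      chart_symm_smul hv ht.1
  have herror : ContinuousOn
      (fun t : ℝ => ‖c.conjError g (c.chart.symm (t • v))‖ - A * t * ‖v‖ ^ 2) J := by
    unfold conjError
    fun_prop
  convert herror.preimage_isClosed_of_isClosed hJ (isClosed_Iic (a := 0)) using 1
  ext t
  simp only [rayControl, J, mem_inter_iff, mem_ofPred_eq, mem_preimage, mem_Iic, sub_nonpos]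
  tauto

theorem eventually_mem_rayControl (hg : ‖c.ad g‖ ≤ C) (hA : 2 + 4 * c.M * (C + 1) ^ 2 ≤ A)
    (hv₀ : v ≠ 0) (hAv : A * ‖v‖ ≤ 1) (hCv : (C + 1) * ‖v‖ ≤ c.r) {t : ℝ}
    (ht : t ∈ Ico (0 : ℝ) 1) (hmem : t ∈ c.rayControl g v A) :
    ∀ᶠ τ in 𝓝[>] t, τ ∈ c.rayControl g v A := by
  have hC : 0 ≤ C := (norm_nonneg _).trans hg
  have hv : ‖v‖ ≤ c.r := by nlinarith [norm_nonneg v]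
  have hz : Tendsto (fun τ : ℝ => (c.chart.symm (t • v))⁻¹ * c.chart.symm (τ • v)) (𝓝[>] t)
      (𝓝 1) := by
    have h := (continuousAt_symm_smul hv ⟨ht.1, ht.2.le⟩).tendsto.const_mul
      (c.chart.symm (t • v))⁻¹
    rw [inv_mul_cancel] at h
    exact h.mono_left nhdsWithin_le_nhds
  filter_upwards [hz.eventually_mem (c.ball_mem_nhds c.r_pos),
    ((tendsto_conj g).comp hz).eventually_mem (c.ball_mem_nhds c.r_pos),
    hz.eventually (c.eventually_norm_conjError_le g (norm_pos_iff.2 hv₀)), Ioc_mem_nhdsGT ht.2]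
    with τ hzr hgz hzv hτ
  exact mem_rayControl_of_mul hg hA hAv hCv ht.1 hτ.1.le hτ.2 hmem hzr hgz hzv
    (mul_inv_cancel_left _ _)

theorem Icc_subset_rayControl (hg : ‖c.ad g‖ ≤ C) (hA : 2 + 4 * c.M * (C + 1) ^ 2 ≤ A)
    (hv₀ : v ≠ 0) (hAv : A * ‖v‖ ≤ 1) (hCv : (C + 1) * ‖v‖ ≤ c.r) :
    Icc 0 1 ⊆ c.rayControl g v A := by
  have hC : 0 ≤ C := (norm_nonneg _).trans hg
  have hv : ‖v‖ ≤ c.r := by nlinarith [norm_nonneg v]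
  exact (isClosed_rayControl_inter_Icc hv).Icc_subset_of_forall_mem_nhdsWithin
    zero_mem_rayControl fun t ht => eventually_mem_rayControl hg hA hv₀ hAv hCv ht.2 ht.1

theorem conj_mem_ball_and_norm_conjError_le (hg : ‖c.ad g‖ ≤ C)
    (hA : 2 + 4 * c.M * (C + 1) ^ 2 ≤ A) (hx : x ∈ c.chart.source) (hAx : A * ‖c.chart x‖ ≤ 1)
    (hCx : (C + 1) * ‖c.chart x‖ ≤ c.r) :
    g * x * g⁻¹ ∈ c.ball ((C + 1) * ‖c.chart x‖) ∧
      ‖c.conjError g x‖ ≤ A * ‖c.chart x‖ ^ 2 := by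
  rcases eq_or_ne (c.chart x) 0 with h₀ | h₀
  · obtain rfl : x = 1 := by rw [← c.chart.left_inv hx, h₀, c.symm_zero]
    simp [conjError, coordBall, c.map_one, c.one_mem_source]
  · have h := Icc_subset_rayControl hg hA h₀ hAx hCx (right_mem_Icc.2 zero_le_one)
    rw [rayControl, mem_ofPred_eq, one_smul, mul_one, c.chart.left_inv hx] at h
    refine ⟨conj_mem_ball_of_norm_conjError_le hg h.1.1 le_rfl (h.2.trans ?_), h.2⟩
    linarith [mul_le_mul_of_nonneg_right hAx (norm_nonneg (c.chart x))]

theorem exists_eventually_conj_mem_ball (c : QuadraticChart U E) (C : ℝ) :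
    ∃ L, 1 ≤ L ∧ ∀ᶠ x in 𝓝 (1 : U), ∀ g, ‖c.ad g‖ ≤ C →
      g * x * g⁻¹ ∈ c.ball (L * ‖c.chart x‖) ∧ ‖c.conjError g x‖ ≤ L * ‖c.chart x‖ ^ 2 := by
  obtain ⟨A, hA⟩ : ∃ A, 2 + 4 * c.M * (C + 1) ^ 2 ≤ A := ⟨_, le_rfl⟩
  have hsmall (a : ℝ) {b : ℝ} (hb : 0 < b) : ∀ᶠ x in 𝓝 (1 : U), a * ‖c.chart x‖ ≤ b :=
    Tendsto.eventually_le_const hb (by simpa using c.tendsto_chart.norm.const_mul a)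
  refine ⟨max 1 (max A (C + 1)), le_max_left _ _, ?_⟩
  filter_upwards [hsmall A one_pos, hsmall (C + 1) c.r_pos,
    c.chart.open_source.mem_nhds c.one_mem_source] with x hAx hCx hx g hg
  obtain ⟨hball, herror⟩ := conj_mem_ball_and_norm_conjError_le hg hA hx hAx hCx
  refine ⟨coordBall_mono ?_ hball, herror.trans ?_⟩ <;> gcongr <;> simp

theorem eventually_conj_mem (c : QuadraticChart U E) (C : ℝ) {W : Set U} (hW : W ∈ 𝓝 1) :
    ∀ᶠ x in 𝓝 (1 : U), ∀ g, ‖c.ad g‖ ≤ C → g * x * g⁻¹ ∈ W := by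
  obtain ⟨L, -, hconj⟩ := c.exists_eventually_conj_mem_ball C
  obtain ⟨ρ, hρW, hρ⟩ := ((eventually_coordBall_subset c.one_mem_source c.map_one hW).and
    self_mem_nhdsWithin).exists
  have hsmall : ∀ᶠ x in 𝓝 (1 : U), L * ‖c.chart x‖ ≤ ρ :=
    Tendsto.eventually_le_const hρ (by simpa using c.tendsto_chart.norm.const_mul L)
  filter_upwards [hconj, hsmall] with x hx hxρ g hg
  exact hρW (coordBall_mono hxρ (hx g hg).1)

end UniformConj

/-! ### Correction of approximate morphisms -/

section Correction

variable {K : Type*} [Group K] {φ γ : K → U} {L ε : ℝ}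

theorem norm_mulDefect_cocycle_le (hL : 1 ≤ L) (hε : L * ε ≤ c.r)
    (hconj : ∀ s, ∀ x ∈ c.ball ε, φ s * x * (φ s)⁻¹ ∈ c.ball (L * ε) ∧
      ‖c.conjError (φ s) x‖ ≤ L * ε ^ 2)
    (hdefect : ∀ s t, mulDefect φ s t ∈ c.ball ε) (r s t : K) :
    ‖c.chart (mulDefect φ r s) + c.chart (mulDefect φ (r * s) t) -
      c.ad (φ r) (c.chart (mulDefect φ s t)) - c.chart (mulDefect φ r (s * t))‖ ≤
      (2 * c.M * L ^ 2 + L) * ε ^ 2 := by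
  have hε₀ : 0 ≤ ε := (norm_nonneg _).trans (hdefect r s).2
  have hball (s t : K) : mulDefect φ s t ∈ c.ball (L * ε) :=
    coordBall_mono (le_mul_of_one_le_left hε₀ hL) (hdefect s t)
  obtain ⟨hconjmem, herror⟩ := hconj r _ (hdefect s t)
  have hleft := norm_mul_sub_sub_le_sq hε (hball r s) (hball (r * s) t)
  have hright := norm_mul_sub_sub_le_sq hε hconjmem (hball r (s * t))
  rw [mulDefect_mul_mulDefect] at hleft
  calc _ = ‖c.conjError (φ r) (mulDefect φ s t) +
        (c.chart (φ r * mulDefect φ s t * (φ r)⁻¹ * mulDefect φ r (s * t)) -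
          c.chart (φ r * mulDefect φ s t * (φ r)⁻¹) - c.chart (mulDefect φ r (s * t))) -
        (c.chart (φ r * mulDefect φ s t * (φ r)⁻¹ * mulDefect φ r (s * t)) -
          c.chart (mulDefect φ r s) - c.chart (mulDefect φ (r * s) t))‖ := by
        rw [conjError]
        congr 1
        abel
    _ ≤ L * ε ^ 2 + c.M * (L * ε) ^ 2 + c.M * (L * ε) ^ 2 :=
      norm_sub_le_of_le (norm_add_le_of_le herror hright) hleft
    _ = _ := by ring

theorem mulDefect_mul_mem_ball {e : ℝ} (hL : 1 ≤ L) (hε : 6 * (L * ε) ≤ c.r)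
    (hconj : ∀ s, ∀ x ∈ c.ball ε, φ s * x * (φ s)⁻¹ ∈ c.ball (L * ε) ∧
      ‖c.conjError (φ s) x‖ ≤ L * ε ^ 2)
    (hγ : ∀ s, γ s ∈ c.ball ε) {r s : K} (hdefect : mulDefect φ r s ∈ c.ball ε)
    (hcoboundary : ‖c.chart (mulDefect φ r s) - c.chart (γ (r * s)) +
      c.ad (φ r) (c.chart (γ s)) + c.chart (γ r)‖ ≤ e) :
    mulDefect (γ * φ) r s ∈ c.ball (e + (42 * c.M * L ^ 2 + L) * ε ^ 2) := by
  have hε₀ : 0 ≤ ε := (norm_nonneg _).trans (hγ r).2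
  have hball {x : U} (hx : x ∈ c.ball ε) : x ∈ c.ball (L * ε) :=
    coordBall_mono (le_mul_of_one_le_left hε₀ hL) hx
  obtain ⟨hconjmem, herror⟩ := hconj r _ (hγ s)
  have hprod := norm_mul_mul_mul_inv_sub_le hε (hball (hγ r)) hconjmem (hball hdefect)
    (hball (hγ (r * s)))
  rw [mulDefect_mul]
  refine ⟨mul_mul_mul_inv_mem_source hε (hball (hγ r)) hconjmem (hball hdefect)
    (hball (hγ (r * s))), ?_⟩
  set p := c.chart (γ r * (φ r * γ s * (φ r)⁻¹) * (mulDefect φ r s * (γ (r * s))⁻¹))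
  calc ‖p‖ = ‖c.chart (mulDefect φ r s) - c.chart (γ (r * s)) +
          c.ad (φ r) (c.chart (γ s)) + c.chart (γ r) +
        (p - (c.chart (γ r) + c.chart (φ r * γ s * (φ r)⁻¹) + c.chart (mulDefect φ r s) -
          c.chart (γ (r * s)))) + c.conjError (φ r) (γ s)‖ := by
        rw [conjError]
        congr 1
        abel
    _ ≤ e + 42 * c.M * (L * ε) ^ 2 + L * ε ^ 2 :=
      norm_add_le_of_le (norm_add_le_of_le hcoboundary hprod) herror
    _ = _ := by ring

variable [TopologicalSpace K] [IsTopologicalGroup K] [CompactSpace K] [IsTopologicalGroup U]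
  [CompleteSpace E]

theorem exists_mulDefect_mul_mem_ball (hφ : Continuous φ) (hL : 1 ≤ L) (hε : 6 * (L * ε) ≤ c.r)
    (hconj : ∀ s, ∀ x ∈ c.ball ε, φ s * x * (φ s)⁻¹ ∈ c.ball (L * ε) ∧
      ‖c.conjError (φ s) x‖ ≤ L * ε ^ 2)
    (hdefect : ∀ s t, mulDefect φ s t ∈ c.ball ε) :
    ∃ γ : K → U, Continuous γ ∧ (∀ s, γ s ∈ c.ball ε) ∧
      ∀ s t, mulDefect (γ * φ) s t ∈ c.ball ((44 * c.M * L ^ 2 + 2 * L) * ε ^ 2) := by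
  have hε₀ : 0 ≤ ε := (norm_nonneg _).trans (hdefect 1 1).2
  have hεL : ε ≤ L * ε := le_mul_of_one_le_left hε₀ hL
  obtain ⟨b, hb, hbε, hcoboundary⟩ := exists_norm_coboundary_sub_le
    (c.chart.continuousOn.comp_continuous (continuous_mulDefect hφ) fun p => (hdefect p.1 p.2).1)
    (fun s => c.ad (φ s)) (fun p => (hdefect p.1 p.2).2)
    (norm_mulDefect_cocycle_le hL (by linarith) hconj hdefect)
  have hbtarget (s : K) : -b s ∈ c.chart.target := by
    refine c.closedBall_subset_target (mem_closedBall_zero_iff.2 ?_)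
    rw [norm_neg]
    linarith [hbε s]
  set γ : K → U := fun s => c.chart.symm (-b s)
  have hγb (s : K) : c.chart (γ s) = -b s := c.chart.right_inv (hbtarget s)
  have hγ (s : K) : γ s ∈ c.ball ε :=
    coordBall_mono ((norm_neg (b s)).le.trans (hbε s)) (symm_mem_coordBall (hbtarget s))
  refine ⟨γ, c.chart.continuousOn_symm.comp_continuous hb.neg hbtarget, hγ, fun r s => ?_⟩
  have hγcoboundary : ‖c.chart (mulDefect φ r s) - c.chart (γ (r * s)) +
      c.ad (φ r) (c.chart (γ s)) + c.chart (γ r)‖ ≤ (2 * c.M * L ^ 2 + L) * ε ^ 2 := by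
    simpa only [hγb, map_neg, Function.comp_apply, sub_neg_eq_add, ← sub_eq_add_neg] using
      hcoboundary r s
  exact coordBall_mono (by linarith)
    (mulDefect_mul_mem_ball hL hε hconj hγ (hdefect r s) hγcoboundary)

end Correction

/-- Below the scale `ρ`, every approximate morphism from `K` with adjoint operators bounded by `C`
can be corrected to one with half the defect, by a factor no larger than the defect. -/
def IsCorrectionRadius (c : QuadraticChart U E) (K : Type*) [Group K] [TopologicalSpace K]
    (C ρ : ℝ) : Prop :=
  ∀ (φ : K → U) (ε : ℝ), ε ≤ ρ → Continuous φ → (∀ s, ‖c.ad (φ s)‖ ≤ C) →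
    (∀ s t, mulDefect φ s t ∈ c.ball ε) →
    ∃ γ : K → U, Continuous γ ∧ (∀ s, γ s ∈ c.ball ε) ∧
      ∀ s t, mulDefect (γ * φ) s t ∈ c.ball (ε / 2)

theorem exists_isCorrectionRadius [IsTopologicalGroup U] [CompleteSpace E]
    (c : QuadraticChart U E) (C : ℝ) {W : Set U} (hW : W ∈ 𝓝 1) :
    ∃ ρ > 0, ρ ≤ c.r ∧ c.ball ρ ⊆ W ∧
      ∀ (K : Type*) [Group K] [TopologicalSpace K] [IsTopologicalGroup K] [CompactSpace K],
        c.IsCorrectionRadius K C ρ := by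
  obtain ⟨L, hL, hconj⟩ := c.exists_eventually_conj_mem_ball C
  have hM := c.M_nonneg
  set B := 44 * c.M * L ^ 2 + 2 * L
  have hsmall (a : ℝ) {b : ℝ} (hb : 0 < b) : ∀ᶠ ρ in 𝓝[>] (0 : ℝ), a * ρ ≤ b :=
    nhdsWithin_le_nhds ((Continuous.tendsto' (by fun_prop) 0 0 (by simp)).eventually_le_const hb)
  obtain ⟨ρ, hρWV, hρr, hρB, hρ : 0 < ρ⟩ := ((eventually_coordBall_subset c.one_mem_source
    c.map_one (inter_mem hW hconj)).and ((hsmall (6 * L) c.r_pos).and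
      ((hsmall B one_half_pos).and self_mem_nhdsWithin))).exists
  refine ⟨ρ, hρ, by nlinarith, fun x hx => (hρWV hx).1, fun K _ _ _ _ φ ε hερ hφ had hdefect => ?_⟩
  have hε₀ : 0 ≤ ε := (norm_nonneg _).trans (hdefect 1 1).2
  have hεr : 6 * (L * ε) ≤ c.r := by nlinarith
  have hεconj (s : K) (x : U) (hx : x ∈ c.ball ε) : φ s * x * (φ s)⁻¹ ∈ c.ball (L * ε) ∧
      ‖c.conjError (φ s) x‖ ≤ L * ε ^ 2 := by
    obtain ⟨hmem, herror⟩ := (hρWV (coordBall_mono hερ hx)).2 (φ s) (had s)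
    exact ⟨coordBall_mono (by gcongr; exact hx.2) hmem, herror.trans (by gcongr; exact hx.2)⟩
  obtain ⟨γ, hγ, hγε, hγdefect⟩ := exists_mulDefect_mul_mem_ball hφ hL hεr hεconj hdefect
  refine ⟨γ, hγ, hγε, fun s t => coordBall_mono ?_ (hγdefect s t)⟩
  calc B * ε ^ 2 = B * ε * ε := by ring
    _ ≤ B * ρ * ε := by gcongr
    _ ≤ 1 / 2 * ε := by gcongr
    _ = ε / 2 := by ring

section Iteration

variable {K : Type*} [Group K] [TopologicalSpace K] {φ w : K → U} {n : ℕ} {C ρ : ℝ}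

/-- `w` is an admissible outcome of `n` correction steps applied to `φ`: the defect of `w * φ` has
been halved `n` times, while `w` stays within the first `n` terms of a geometric series. -/
structure IsPartialCorrection (c : QuadraticChart U E) (φ : K → U) (ρ : ℝ) (n : ℕ)
    (w : K → U) : Prop where
  continuous : Continuous w
  mem_ball : ∀ s, w s ∈ c.ball (ρ * (1 - (1 / 2) ^ n))
  mulDefect_mem : ∀ s t, mulDefect (w * φ) s t ∈ c.ball (ρ / 4 / 2 ^ n)

theorem isPartialCorrection_one (hdefect : ∀ s t, mulDefect φ s t ∈ c.ball (ρ / 4)) :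
    c.IsPartialCorrection φ ρ 0 1 where
  continuous := continuous_const
  mem_ball _ := ⟨c.one_mem_source, by simp [c.map_one]⟩
  mulDefect_mem s t := by simpa using hdefect s t

theorem IsPartialCorrection.mem_ball_self (hw : c.IsPartialCorrection φ ρ n w) (hρ : 0 ≤ ρ)
    (s : K) : w s ∈ c.ball ρ :=
  coordBall_mono (mul_le_of_le_one_right hρ (sub_le_self 1 (by positivity))) (hw.mem_ball s)

variable [IsTopologicalGroup U]

theorem IsPartialCorrection.exists_succ (hw : c.IsPartialCorrection φ ρ n w)
    (hcorrection : c.IsCorrectionRadius K (2 * C) ρ) (hρ : 0 ≤ ρ) (hρr : ρ ≤ c.r)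
    (hφ : Continuous φ) (had : ∀ s, ‖c.ad (φ s)‖ ≤ C) :
    ∃ w', c.IsPartialCorrection φ ρ (n + 1) w' ∧
      ∀ s, dist (c.chart (w s)) (c.chart (w' s)) ≤ ρ / 2 / 2 ^ n := by
  set δ := ρ / 4 / 2 ^ n with hδ
  have hδρ : δ ≤ ρ := by
    have : δ ≤ ρ / 4 := div_le_self (by positivity) (one_le_pow₀ one_le_two)
    linarith
  have hwr (s : K) : w s ∈ c.ball c.r := coordBall_mono hρr (hw.mem_ball_self hρ s)
  obtain ⟨γ, hγ, hγδ, hγdefect⟩ := hcorrection (w * φ) δ hδρ (hw.continuous.mul hφ)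
    (fun s => norm_ad_mul_le (hwr s) (had s)) hw.mulDefect_mem
  have hγr (s : K) : γ s ∈ c.ball c.r := coordBall_mono (hδρ.trans hρr) (hγδ s)
  have hdist (s : K) : ‖c.chart ((γ * w) s) - c.chart (w s)‖ ≤ ρ / 2 / 2 ^ n :=
    calc _ ≤ 2 * ‖c.chart (γ s)‖ := norm_mul_sub_le (hγr s) (hwr s)
      _ ≤ 2 * δ := by gcongr; exact (hγδ s).2
      _ = ρ / 2 / 2 ^ n := by rw [hδ]; ring
  refine ⟨γ * w, ⟨hγ.mul hw.continuous, fun s => ⟨c.mul_mem_source _ (hγr s) _ (hwr s), ?_⟩,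
    fun s t => ?_⟩, fun s => (dist_comm _ _).trans_le ((dist_eq_norm _ _).trans_le (hdist s))⟩
  · calc ‖c.chart ((γ * w) s)‖ ≤ ‖c.chart (w s)‖ + ‖c.chart ((γ * w) s) - c.chart (w s)‖ :=
          norm_le_norm_add_norm_sub' _ _
      _ ≤ ρ * (1 - (1 / 2) ^ n) + ρ / 2 / 2 ^ n := add_le_add (hw.mem_ball s).2 (hdist s)
      _ = ρ * (1 - (1 / 2) ^ (n + 1)) := by
        rw [pow_succ, one_div, inv_pow]
        field_simp
        ring
  · rw [mul_assoc, pow_succ, ← div_div]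
    exact hγdefect s t

theorem exists_monoidHom_of_isPartialCorrection [T2Space U] [CompleteSpace E] {w : ℕ → K → U}
    (hw : ∀ n, c.IsPartialCorrection φ ρ n (w n)) (hρ : 0 ≤ ρ) (hρr : ρ ≤ c.r)
    (hφ : Continuous φ)
    (hdist : ∀ n s, dist (c.chart (w n s)) (c.chart (w (n + 1) s)) ≤ ρ / 2 / 2 ^ n) :
    ∃ ψ : K →* U, Continuous ψ ∧ ∀ s, ψ s * (φ s)⁻¹ ∈ c.ball ρ := by
  obtain ⟨w', hw', hw'ρ, hlim⟩ := exists_continuous_tendsto_of_coord_geometric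
    ((closedBall_subset_closedBall hρr).trans c.closedBall_subset_target)
    (fun n => (hw n).continuous) (fun n => (hw n).mem_ball_self hρ) hdist
  have hdefect (s t : K) : Tendsto (fun n => mulDefect (w n * φ) s t) atTop (𝓝 1) := by
    have hpow : Tendsto (fun n : ℕ => ρ / 4 / 2 ^ n) atTop (𝓝 0) :=
      tendsto_const_nhds.div_atTop (tendsto_pow_atTop_atTop_of_one_lt one_lt_two)
    refine tendsto_def.2 fun W hW => ?_
    obtain ⟨σ, hσW, hσ : 0 < σ⟩ := ((eventually_coordBall_subset c.one_mem_source c.map_one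
      hW).and self_mem_nhdsWithin).exists
    filter_upwards [hpow.eventually_le_const hσ] with n hn
    exact hσW (coordBall_mono hn ((hw n).mulDefect_mem s t))
  have hlimφ (s : K) : Tendsto (fun n => (w n * φ) s) atTop (𝓝 ((w' * φ) s)) :=
    (hlim s).mul_const (φ s)
  refine ⟨MonoidHom.mk' (w' * φ) (map_mul_of_tendsto_mulDefect hlimφ hdefect), hw'.mul hφ,
    fun s => ?_⟩
  simpa using hw'ρ s

theorem IsCorrectionRadius.exists_monoidHom [T2Space U] [CompleteSpace E]
    (hcorrection : c.IsCorrectionRadius K (2 * C) ρ) (hρ : 0 ≤ ρ) (hρr : ρ ≤ c.r)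
    (hφ : Continuous φ) (had : ∀ s, ‖c.ad (φ s)‖ ≤ C)
    (hdefect : ∀ s t, mulDefect φ s t ∈ c.ball (ρ / 4)) :
    ∃ ψ : K →* U, Continuous ψ ∧ ∀ s, ψ s * (φ s)⁻¹ ∈ c.ball ρ := by
  have hsucc (n : ℕ) (w : K → U) (hw : c.IsPartialCorrection φ ρ n w) :=
    hw.exists_succ hcorrection hρ hρr hφ had
  choose! next hnext hdist using hsucc
  let w (n : ℕ) : K → U := n.rec 1 next
  have hw (n : ℕ) : c.IsPartialCorrection φ ρ n (w n) := by
    induction n with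
    | zero => exact isPartialCorrection_one hdefect
    | succ n ih => exact hnext n _ ih
  exact exists_monoidHom_of_isPartialCorrection hw hρ hρr hφ fun n => hdist n _ (hw n)

end Iteration

variable [IsTopologicalGroup U] [T2Space U] [CompleteSpace E]

theorem exists_monoidHom_mul_inv_mem (c : QuadraticChart U E) (C : ℝ) {W : Set U}
    (hW : W ∈ 𝓝 1) :
    ∃ V ∈ 𝓝 (1 : U), ∀ (K : Type*) [Group K] [TopologicalSpace K] [IsTopologicalGroup K]
      [CompactSpace K] (φ : K → U), Continuous φ → (∀ s, ‖c.ad (φ s)‖ ≤ C) →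
      (∀ s t, mulDefect φ s t ∈ V) →
      ∃ ψ : K →* U, Continuous ψ ∧ ∀ s, ψ s * (φ s)⁻¹ ∈ W := by
  obtain ⟨ρ, hρ, hρr, hρW, hcorrection⟩ := c.exists_isCorrectionRadius (2 * C) hW
  refine ⟨c.ball (ρ / 4), c.ball_mem_nhds (by positivity), fun K _ _ _ _ φ hφ had hdefect => ?_⟩
  obtain ⟨ψ, hψ, hψφ⟩ := (hcorrection K).exists_monoidHom hρ.le hρr hφ had hdefect
  exact ⟨ψ, hψ, fun s => hρW (hψφ s)⟩

theorem exists_monoidHom_inv_mul_mem (c : QuadraticChart U E) (C : ℝ) {W : Set U}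
    (hW : W ∈ 𝓝 1) :
    ∃ V ∈ 𝓝 (1 : U), ∀ (K : Type*) [Group K] [TopologicalSpace K] [IsTopologicalGroup K]
      [CompactSpace K] (φ : K → U), Continuous φ → (∀ s, ‖c.ad (φ s)‖ ≤ C) →
      (∀ s t, (φ (s * t))⁻¹ * (φ s * φ t) ∈ V) →
      ∃ ψ : K →* U, Continuous ψ ∧ ∀ s, (φ s)⁻¹ * ψ s ∈ W := by
  obtain ⟨V, hV, hright⟩ := c.exists_monoidHom_mul_inv_mem C (inter_mem
    (c.ball_mem_nhds c.r_pos) (c.eventually_conj_mem (2 * C) hW))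
  refine ⟨_, c.eventually_conj_mem C hV, fun K _ _ _ _ φ hφ had hdefect => ?_⟩
  obtain ⟨ψ, hψ, hψφ⟩ := hright K φ hφ had fun s t => by
    simpa only [mulDefect, mul_inv_cancel_left] using hdefect s t _ (had (s * t))
  have hadψ (s : K) : ‖c.ad (ψ s)‖ ≤ 2 * C := by
    simpa using norm_ad_mul_le (hψφ s).1 (had s)
  refine ⟨ψ, hψ, fun s => ?_⟩
  have hmem := (hψφ s).2 _ (hadψ s⁻¹)
  have hconj : ψ s⁻¹ * (ψ s * (φ s)⁻¹) * (ψ s⁻¹)⁻¹ = (φ s)⁻¹ * ψ s := by simp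
  rwa [hconj] at hmem

end QuadraticChart

/-! ### The chart at the identity of a Lie group -/

/-- Mean value inequality for `v ↦ f (u, v) - f (a, v)`, whose derivative is `O(‖u - a‖)` because
`fderiv ℝ f` is Lipschitz near `(a, b)`. -/
theorem exists_eventually_norm_mixed_sub_le {E F G : Type*} [NormedAddCommGroup E]
    [NormedSpace ℝ E] [NormedAddCommGroup F] [NormedSpace ℝ F] [NormedAddCommGroup G]
    [NormedSpace ℝ G] {f : E × F → G} {a : E} {b : F} (hf : ContDiffAt ℝ 2 f (a, b)) :
    ∃ M : ℝ, 0 ≤ M ∧ ∀ᶠ p in 𝓝 (a, b),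
      ‖f p - f (a, p.2) - (f (p.1, b) - f (a, b))‖ ≤ M * ‖p.1 - a‖ * ‖p.2 - b‖ := by
  obtain ⟨M, t, ht, hlip⟩ := (hf.fderiv_right (m := 1) le_rfl).exists_lipschitzOnWith
  have hdiff : ∀ᶠ p in 𝓝 (a, b), DifferentiableAt ℝ f p :=
    (hf.eventually (by simp)).mono fun p hp => hp.differentiableAt (by simp)
  obtain ⟨r, hr, hball⟩ := Metric.mem_nhds_iff.1 (inter_mem ht hdiff)
  refine ⟨M, M.2, ?_⟩
  rw [← ball_prod_same] at hball
  filter_upwards [prod_mem_nhds (ball_mem_nhds a hr) (ball_mem_nhds b hr)]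
  rintro ⟨u, v⟩ ⟨hu : u ∈ ball a r, hv : v ∈ ball b r⟩
  have hder {u' : E} (hu' : u' ∈ ball a r) {w : F} (hw : w ∈ ball b r) :
      HasFDerivAt (fun w => f (u', w)) ((fderiv ℝ f (u', w)).comp (.inr ℝ E F)) w :=
    (hball ⟨hu', hw⟩).2.hasFDerivAt.comp w (hasFDerivAt_prodMk_right u' w)
  have ha : a ∈ ball a r := mem_ball_self hr
  refine (convex_ball b r).norm_image_sub_le_of_norm_hasFDerivWithin_le
    (f := fun w => f (u, w) - f (a, w)) (C := M * ‖u - a‖)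
    (fun w hw => ((hder hu hw).sub (hder ha hw)).hasFDerivWithinAt)
    (fun w hw => ?_) (mem_ball_self hr) hv
  calc ‖(fderiv ℝ f (u, w)).comp (.inr ℝ E F) - (fderiv ℝ f (a, w)).comp (.inr ℝ E F)‖
      = ‖(fderiv ℝ f (u, w) - fderiv ℝ f (a, w)).comp (.inr ℝ E F)‖ := by
        rw [ContinuousLinearMap.sub_comp]
    _ ≤ ‖fderiv ℝ f (u, w) - fderiv ℝ f (a, w)‖ :=
        (ContinuousLinearMap.opNorm_comp_le _ _).trans (mul_le_of_le_one_right (norm_nonneg _)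
          (ContinuousLinearMap.norm_inr_le_one ℝ E F))
    _ ≤ M * ‖(u, w) - (a, w)‖ := hlip.norm_sub_le (hball ⟨hu, hw⟩).1 (hball ⟨ha, hw⟩).1
    _ = M * ‖u - a‖ := by simp [Prod.norm_def]

section CenteredChart

variable {U E : Type*} [TopologicalSpace U] [NormedAddCommGroup E]
  {κ : OpenPartialHomeomorph U E}

theorem eventually_isClosed_coordBall [RegularSpace U] {x : U} (hx : x ∈ κ.source)
    (hκx : κ x = 0) : ∀ᶠ ρ in 𝓝[>] (0 : ℝ), IsClosed (coordBall κ ρ) := by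
  obtain ⟨s, hs, hsclosed, hsκ⟩ := exists_mem_nhds_isClosed_subset (κ.open_source.mem_nhds hx)
  filter_upwards [eventually_coordBall_subset hx hκx hs] with ρ hρ
  have hball : coordBall κ ρ = s ∩ (fun y => ‖κ y‖) ⁻¹' Iic ρ :=
    Subset.antisymm (fun y hy => ⟨hρ hy, hy.2⟩) fun y hy => ⟨hsκ hy.1, hy.2⟩
  rw [hball]
  exact (κ.continuousOn.mono hsκ).norm.preimage_isClosed_of_isClosed hsclosed isClosed_Iic

variable [Group U]

theorem exists_eventually_norm_mul_sub_sub_le [NormedSpace ℝ E] (h1 : 1 ∈ κ.source)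
    (hκ1 : κ 1 = 0)
    (hmul : ContDiffAt ℝ 2 (fun p : E × E => κ (κ.symm p.1 * κ.symm p.2)) (0, 0)) :
    ∃ M : ℝ, 0 ≤ M ∧ ∀ᶠ p : U × U in 𝓝 1 ×ˢ 𝓝 1,
      ‖κ (p.1 * p.2) - κ p.1 - κ p.2‖ ≤ M * ‖κ p.1‖ * ‖κ p.2‖ := by
  obtain ⟨M, hM, hbound⟩ := exists_eventually_norm_mixed_sub_le hmul
  have hκsymm : κ.symm 0 = 1 := hκ1 ▸ κ.left_inv h1
  have hκ : Tendsto κ (𝓝 1) (𝓝 0) := hκ1 ▸ κ.continuousAt h1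
  have hsource := κ.open_source.mem_nhds h1
  rw [nhds_prod_eq] at hbound
  refine ⟨M, hM, ?_⟩
  filter_upwards [(hκ.prodMap hκ).eventually hbound, prod_mem_prod hsource hsource]
    with ⟨x, y⟩ hxy ⟨hx, hy⟩
  simpa [Prod.map, hκsymm, hκ1, κ.left_inv hx, κ.left_inv hy, sub_right_comm] using hxy

theorem eventually_norm_inv_add_le [IsTopologicalGroup U] (h1 : 1 ∈ κ.source) (hκ1 : κ 1 = 0)
    {M : ℝ} (hM : 0 ≤ M)
    (hmul : ∀ᶠ p : U × U in 𝓝 1 ×ˢ 𝓝 1,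
      ‖κ (p.1 * p.2) - κ p.1 - κ p.2‖ ≤ M * ‖κ p.1‖ * ‖κ p.2‖) :
    ∀ᶠ x in 𝓝 (1 : U), ‖κ x⁻¹ + κ x‖ ≤ 2 * M * ‖κ x‖ ^ 2 := by
  have hinv : Tendsto (fun x : U => x⁻¹) (𝓝 1) (𝓝 1) := by simpa using tendsto_inv (1 : U)
  have hκ : Tendsto (fun x => M * ‖κ x‖) (𝓝 1) (𝓝 0) := by
    simpa [hκ1] using (κ.continuousAt h1).tendsto.norm.const_mul M
  filter_upwards [(tendsto_id.prodMk hinv).eventually hmul,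
    hκ.eventually_le_const one_half_pos] with x hx hsmall
  have hquad : ‖κ x⁻¹ + κ x‖ ≤ M * ‖κ x‖ * ‖κ x⁻¹‖ := by
    rw [add_comm, ← norm_neg, neg_add', ← zero_sub (κ x), ← hκ1, ← mul_inv_cancel x]
    exact hx
  have hnorm : ‖κ x⁻¹‖ ≤ 2 * ‖κ x‖ := by
    have := norm_le_norm_add_norm_sub' (κ x⁻¹) (-κ x)
    rw [norm_neg, sub_neg_eq_add] at this
    linarith [mul_le_mul_of_nonneg_right hsmall (norm_nonneg (κ x⁻¹))]
  calc ‖κ x⁻¹ + κ x‖ ≤ M * ‖κ x‖ * ‖κ x⁻¹‖ := hquad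
    _ ≤ M * ‖κ x‖ * (2 * ‖κ x‖) := by gcongr
    _ = 2 * M * ‖κ x‖ ^ 2 := by ring

theorem QuadraticChart.exists_chart_eq [IsTopologicalGroup U] [RegularSpace U] [NormedSpace ℝ E]
    (h1 : 1 ∈ κ.source) (hκ1 : κ 1 = 0)
    (hmul : ContDiffAt ℝ 2 (fun p : E × E => κ (κ.symm p.1 * κ.symm p.2)) (0, 0))
    (hconj : ∀ g, DifferentiableAt ℝ (fun v => κ (g * κ.symm v * g⁻¹)) 0) :
    ∃ c : QuadraticChart U E, c.chart = κ := by
  obtain ⟨M, hM, hmulM⟩ := exists_eventually_norm_mul_sub_sub_le h1 hκ1 hmul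
  have hinv := eventually_norm_inv_add_le h1 hκ1 hM hmulM
  have hsource := κ.open_source.mem_nhds h1
  have htarget : κ.target ∈ 𝓝 0 := hκ1 ▸ κ.open_target.mem_nhds (κ.map_source h1)
  have hmul_source : ∀ᶠ p : U × U in 𝓝 1 ×ˢ 𝓝 1, p.1 * p.2 ∈ κ.source := by
    rw [← nhds_prod_eq]
    exact (continuous_mul.tendsto' (1, 1) 1 (mul_one 1)).eventually hsource
  have hinv_source : ∀ᶠ x : U in 𝓝 1, x⁻¹ ∈ κ.source :=
    (continuous_inv.tendsto' 1 1 inv_one).eventually hsource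
  obtain ⟨W, hW, hWmul⟩ := eventually_prod_self_iff'.1 (hmulM.and hmul_source)
  have hsmall : ∀ᶠ ρ in 𝓝[>] (0 : ℝ), 2 * M * ρ ≤ 1 / 8 :=
    (((continuous_const_mul (2 * M)).tendsto' 0 0 (mul_zero _)).mono_left
      nhdsWithin_le_nhds).eventually_le_const (by norm_num)
  obtain ⟨r, hr, hrM, hrW, hrinv, hrclosed, hrtarget⟩ := (eventually_mem_nhdsWithin.and
    (hsmall.and ((eventually_coordBall_subset h1 hκ1 hW).and
    ((eventually_coordBall_subset h1 hκ1 (hinv.and hinv_source)).and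
    ((eventually_isClosed_coordBall h1 hκ1).and
    (nhdsWithin_le_nhds (eventually_closedBall_subset htarget))))))).exists
  exact ⟨{
    chart := κ
    r := r
    M := 2 * M
    r_pos := hr
    M_nonneg := by positivity
    M_mul_r_le := hrM
    one_mem_source := h1
    map_one := hκ1
    closedBall_subset_target := hrtarget
    isClosed_coordBall := hrclosed
    mul_mem_source x hx y hy := (hWmul x (hrW hx) y (hrW hy)).2
    norm_mul_sub_sub_le x hx y hy := (hWmul x (hrW hx) y (hrW hy)).1.trans (by gcongr; linarith)
    inv_mem_source x hx := (hrinv hx).2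
    norm_inv_add_le x hx := (hrinv hx).1
    differentiableAt_conj := hconj }, rfl⟩

end CenteredChart

section ChartAtOne

variable {𝕜 : Type*} [RCLike 𝕜] {E : Type*} [NormedAddCommGroup E] [NormedSpace 𝕜 E]
  {U : Type*} [TopologicalSpace U] [ChartedSpace E U] [Group U] {n : WithTop ℕ∞}

/-- The preferred chart at `1`, translated so that `1` has coordinate `0`. -/
noncomputable def chartAtOne (E : Type*) [NormedAddCommGroup E] (U : Type*) [TopologicalSpace U]
    [ChartedSpace E U] [Group U] : OpenPartialHomeomorph U E :=
  (chartAt E (1 : U)).transHomeomorph (Homeomorph.subRight (chartAt E (1 : U) 1))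

theorem one_mem_chartAtOne_source : (1 : U) ∈ (chartAtOne E U).source := mem_chart_source E 1

theorem chartAtOne_one : chartAtOne E U 1 = 0 := sub_self (chartAt E (1 : U) 1)

theorem chartAtOne_symm_zero : (chartAtOne E U).symm 0 = 1 := by
  rw [← chartAtOne_one (U := U), (chartAtOne E U).left_inv one_mem_chartAtOne_source]

theorem contMDiffAt_chartAtOne [IsManifold 𝓘(𝕜, E) n U] :
    ContMDiffAt 𝓘(𝕜, E) 𝓘(𝕜, E) n (chartAtOne E U) 1 :=
  (contMDiffOn_chart.contMDiffAt ((chartAt E (1 : U)).open_source.mem_nhds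
    (mem_chart_source E 1))).sub contMDiffAt_const

theorem contMDiffAt_chartAtOne_symm [IsManifold 𝓘(𝕜, E) n U] :
    ContMDiffAt 𝓘(𝕜, E) 𝓘(𝕜, E) n (chartAtOne E U).symm 0 := by
  have hsymm : ContMDiffAt 𝓘(𝕜, E) 𝓘(𝕜, E) n (chartAt E (1 : U)).symm
      ((fun v : E => v + chartAt E (1 : U) 1) 0) :=
    contMDiffOn_chart_symm.contMDiffAt ((chartAt E (1 : U)).open_target.mem_nhds (by simp))
  exact hsymm.comp (f := fun v : E => v + chartAt E (1 : U) 1) (0 : E)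
    (contMDiffAt_id.add contMDiffAt_const)

variable [LieGroup 𝓘(𝕜, E) n U]

theorem contDiffAt_mul_chartAtOne :
    ContDiffAt 𝕜 n (fun p : E × E =>
      chartAtOne E U ((chartAtOne E U).symm p.1 * (chartAtOne E U).symm p.2)) (0, 0) := by
  rw [← contMDiffAt_iff_contDiffAt]
  have hmul := (contMDiffAt_chartAtOne_symm.comp ((0, 0) : E × E)
    (contMDiffAt_iff_contDiffAt.2 contDiffAt_fst)).mul
    (contMDiffAt_chartAtOne_symm (𝕜 := 𝕜) (n := n) (U := U).comp ((0, 0) : E × E)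
      (contMDiffAt_iff_contDiffAt.2 contDiffAt_snd))
  refine ContMDiffAt.comp (I' := 𝓘(𝕜, E)) ((0, 0) : E × E) ?_ hmul
  simpa [chartAtOne_symm_zero] using contMDiffAt_chartAtOne (𝕜 := 𝕜) (n := n) (E := E) (U := U)

theorem hasFDerivAt_conj_chartAtOne (hn : n ≠ 0) (g : U) :
    HasFDerivAt (fun v => chartAtOne E U (g * (chartAtOne E U).symm v * g⁻¹))
      (lieAd 𝕜 (E := E) g) 0 := by
  have hsmooth : ContMDiff 𝓘(𝕜, E) 𝓘(𝕜, E) n fun x : U => g * x * g⁻¹ :=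
    (contMDiff_const.mul contMDiff_id).mul contMDiff_const
  have hmfderiv := ((hsmooth 1).mdifferentiableAt hn).hasMFDerivAt.2
  have hg : g * 1 * g⁻¹ = 1 := by simp
  simp only [writtenInExtChartAt, mfld_simps, extChartAt, hg] at hmfderiv
  have hchart : HasFDerivAt
      (chartAt E (1 : U) ∘ (fun x => g * x * g⁻¹) ∘ (chartAt E (1 : U)).symm)
      (lieAd 𝕜 (E := E) g) ((fun v : E => v + chartAt E (1 : U) 1) 0) := by
    simp only [zero_add]
    exact hasFDerivWithinAt_univ.1 hmfderiv
  have htranslate : HasFDerivAt (fun v : E => v + chartAt E (1 : U) 1)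
      (ContinuousLinearMap.id 𝕜 E) 0 := (hasFDerivAt_id 0).add_const _
  exact (hchart.comp 0 htranslate).sub_const (chartAt E (1 : U) 1)

end ChartAtOne

theorem exists_quadraticChart_ad_eq_lieAd {𝕜 : Type*} [RCLike 𝕜] {E : Type*}
    [NormedAddCommGroup E] [NormedSpace 𝕜 E] [NormedSpace ℝ E] [IsScalarTower ℝ 𝕜 E] {U : Type*}
    [TopologicalSpace U] [RegularSpace U] [ChartedSpace E U] [Group U] [LieGroup 𝓘(𝕜, E) 2 U] :
    ∃ c : QuadraticChart U E, ∀ g, c.ad g = (lieAd 𝕜 (E := E) g).restrictScalars ℝ := by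
  have : IsTopologicalGroup U := topologicalGroup_of_lieGroup 𝓘(𝕜, E) 2
  have hconj (g : U) :=
    (hasFDerivAt_conj_chartAtOne (𝕜 := 𝕜) (E := E) two_ne_zero g).restrictScalars ℝ
  obtain ⟨c, hc⟩ := QuadraticChart.exists_chart_eq one_mem_chartAtOne_source
    (chartAtOne_one (E := E)) (contDiffAt_mul_chartAtOne (𝕜 := 𝕜) (U := U).restrict_scalars ℝ)
    fun g => (hconj g).differentiableAt
  refine ⟨c, fun g => ?_⟩
  rw [QuadraticChart.ad, hc]
  exact (hconj g).fderiv

section InvariantMetric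

variable {U K : Type*} [Group U] [MetricSpace U] [Group K] {φ : K → U} {δ : ℝ}

theorem IsDeltaMorphism.inv_mul_mem_ball (hφ : IsDeltaMorphism δ φ)
    (hleft : ∀ a x y : U, dist (a * x) (a * y) = dist x y) (s t : K) :
    (φ (s * t))⁻¹ * (φ s * φ t) ∈ ball 1 δ := by
  rw [mem_ball', ← hleft (φ (s * t)), mul_one, mul_inv_cancel_left]
  exact hφ s t

theorem IsDeltaMorphism.mulDefect_mem_ball (hφ : IsDeltaMorphism δ φ)
    (hright : ∀ a x y : U, dist (x * a) (y * a) = dist x y) (s t : K) :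
    mulDefect φ s t ∈ ball 1 δ := by
  rw [mem_ball', ← hright (φ (s * t)), one_mul, mulDefect, inv_mul_cancel_right]
  exact hφ s t

end InvariantMetric

theorem theorem1p1_general {𝕜 : Type*} [RCLike 𝕜]
    {E : Type*} [NormedAddCommGroup E] [NormedSpace 𝕜 E] [CompleteSpace E]
    {U : Type*} [MetricSpace U] [ChartedSpace E U] [Group U] [LieGroup 𝓘(𝕜, E) 2 U]
    (hd : IsLeftOrRightInvariantMetric U)
    (S : Set U) (hS : IsAdBounded 𝕜 (E := E) S) :
    ∀ ε : ℝ, 0 < ε → ∃ δ : ℝ, 0 < δ ∧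
      ∀ (K : Type*) [Group K] [TopologicalSpace K] [IsTopologicalGroup K] [CompactSpace K]
        (φ : K → U), Continuous φ → (∀ s, φ s ∈ S) → IsDeltaMorphism δ φ →
        ∃ ψ : K →* U, Continuous ψ ∧ ∀ s, dist (φ s) (ψ s) < ε := by
  intro ε hε
  have : IsTopologicalGroup U := topologicalGroup_of_lieGroup 𝓘(𝕜, E) 2
  let _ : NormedSpace ℝ E := NormedSpace.restrictScalars ℝ 𝕜 E
  have : IsScalarTower ℝ 𝕜 E := IsScalarTower.of_algebraMap_smul fun _ _ => rfl
  obtain ⟨c, hc⟩ := exists_quadraticChart_ad_eq_lieAd (𝕜 := 𝕜) (E := E) (U := U)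
  obtain ⟨C, hC⟩ := hS
  have had (g : U) (hg : g ∈ S) : ‖c.ad g‖ ≤ C := by
    rw [hc, ContinuousLinearMap.norm_restrictScalars]
    exact hC g hg
  rcases hd with hleft | hright
  · obtain ⟨V, hV, hstable⟩ := c.exists_monoidHom_inv_mul_mem C (ball_mem_nhds 1 hε)
    obtain ⟨δ, hδ, hδV⟩ := Metric.mem_nhds_iff.1 hV
    refine ⟨δ, hδ, fun K _ _ _ _ φ hφ hφS hφδ => ?_⟩
    obtain ⟨ψ, hψ, hψφ⟩ := hstable K φ hφ (fun s => had _ (hφS s))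
      fun s t => hδV (hφδ.inv_mul_mem_ball hleft s t)
    refine ⟨ψ, hψ, fun s => ?_⟩
    rw [← hleft (φ s)⁻¹, inv_mul_cancel]
    exact mem_ball'.1 (hψφ s)
  · obtain ⟨V, hV, hstable⟩ := c.exists_monoidHom_mul_inv_mem C (ball_mem_nhds 1 hε)
    obtain ⟨δ, hδ, hδV⟩ := Metric.mem_nhds_iff.1 hV
    refine ⟨δ, hδ, fun K _ _ _ _ φ hφ hφS hφδ => ?_⟩
    obtain ⟨ψ, hψ, hψφ⟩ := hstable K φ hφ (fun s => had _ (hφS s))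
      fun s t => hδV (hφδ.mulDefect_mem_ball hright s t)
    refine ⟨ψ, hψ, fun s => ?_⟩
    rw [← hright (φ s)⁻¹, mul_inv_cancel]
    exact mem_ball'.1 (hψφ s)

theorem theorem1p1 {𝕜 : Type*} [RCLike 𝕜]
    {E : Type*} [NormedAddCommGroup E] [NormedSpace 𝕜 E] [CompleteSpace E]
    {U : Type*} [MetricSpace U] [ChartedSpace E U] [Group U] [LieGroup 𝓘(𝕜, E) ω U]
    (hd : IsLeftOrRightInvariantMetric U)
    (S : Set U) (hS : IsAdBounded 𝕜 (E := E) S) :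
    ∀ ε : ℝ, 0 < ε → ∃ δ : ℝ, 0 < δ ∧
      ∀ (K : Type*) [Group K] [TopologicalSpace K] [IsTopologicalGroup K] [CompactSpace K]
        (φ : K → U), Continuous φ → (∀ s, φ s ∈ S) → IsDeltaMorphism δ φ →
        ∃ ψ : K →* U, Continuous ψ ∧ ∀ s, dist (φ s) (ψ s) < ε :=
  theorem1p1_general hd S hS
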